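/- Let $k$ be a field, $A$ a (not necessarily commutative) $k$-algebra which is a left and right noetherian domain, and $\mathcal G$ a Lie algebra over $k$, possibly infinite-dimensional, with a totally ordered basis $\{g_i\}_{i\in I}$. Let $B = A\star U\mathcal G$ be a crossed product, i.e. $B$ is a $k$-algebra containing $A$ as a (unital) subalgebra, together with an injective $k$-linear map $\mathcal G\to B$, $g\mapsto \bar g$, such that 1. $\bar g r - r\bar g\in A$ for all $g\in\mathcal G$, $r\in A$ (so that $\delta_g(r)=\bar g r-r\bar g$ is a derivation of $A$); 2. $\bar g\bar h-\bar h\bar g-\overline{[g,h]}\in A$ for all $g,h\in\mathcal G$; 3. $B$ is a free right $A$-module with basis the ordered monomials $\bar g_{i_1}^{j_1}\cdots\bar g_{i_m}^{j_m}$, $i_1<\dots<i_m$. Assume that $B$ has invariant basis number. Let $0\ne g\in\mathcal G$ and let $A[g,\delta]$ be the subalgebra of $B$ generated by $A$ and $\bar g$. Suppose that for some $r,q\in A$ with $r$ not a unit of $A$, the row $(r,\bar g+q)$ is (right) unimodular in $A[g,\delta]$, i.e. $rs+(\bar g+q)t=1$ for some $s,t\in A[g,\delta]$. Then the right ideal $rB\cap(\bar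 g+q)B$ is a non-trivial stably free right $B$-module, i.e. it is a finitely generated stably free right $B$-module ($M\oplus B^n\cong B^m$ for some $n,m\ge 0$) that is not free. -/

import Mathlib

open scoped MulOpposite

namespace CrossedProduct

universe u v w x y

/-- The ordered monomial `ḡ₁^{j₁} ⋯ ḡₘ^{jₘ}` in `B` attached to a finitely supported
family of exponents `j`; the factors are multiplied in increasing order of the index. -/
noncomputable def orderedMonomial {k : Type u} [Field k]
    {G : Type w} [LieRing G] [LieAlgebra k G] {B : Type x} [Ring B] [Algebra k B]
    {ι : Type y} [LinearOrder ι] (b : Module.Basis ι k G) (bar : G →ₗ[k] B)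
    (j : ι →₀ ℕ) : B :=
  ((j.support.sort (· ≤ ·)).map fun i => bar (b i) ^ j i).prod

/-- `B` is a crossed product `A ⋆ U𝒢` of the (noncommutative) `k`-algebra `A` with the
enveloping algebra of the `k`-Lie algebra `G`, which has the ordered basis `b`.
Here `incl` is the inclusion of the subalgebra `A` and `bar` is the linear embedding `g ↦ ḡ`. -/
structure IsCrossedProduct {k : Type u} [Field k] {A : Type v} [Ring A] [Algebra k A]
    {G : Type w} [LieRing G] [LieAlgebra k G] {B : Type x} [Ring B] [Algebra k B]
    {ι : Type y} [LinearOrder ι] (b : Module.Basis ι k G)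
    (incl : A →ₐ[k] B) (bar : G →ₗ[k] B) : Prop where
  /-- `B` contains `A`. -/
  incl_injective : Function.Injective incl
  /-- `g ↦ ḡ` is an embedding of linear spaces. -/
  bar_injective : Function.Injective bar
  /-- `ḡ r - r ḡ` lies in `A`. As a commutator with `ḡ`, the resulting map
  `δ_g : A → A` is automatically a derivation; see `IsCrossedProduct.delta_mul`. -/
  commutator_mem : ∀ (g : G) (r : A), ∃ d : A, bar g * incl r - incl r * bar g = incl d
  /-- `ḡ h̄ - h̄ ḡ` equals the image of `[g, h]` modulo `A`. -/
  bracket_mod : ∀ g h : G, ∃ a : A, bar g * bar h - bar h * bar g = bar ⁅g, h⁆ + incl a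
  /-- `B` is a free right `A`-module on the ordered monomials: each element of `B` is
  `∑ⱼ ḡ^j aⱼ` for exactly one finitely supported family of coefficients `aⱼ ∈ A`. -/
  monomial_basis : Function.Bijective
    (fun f : (ι →₀ ℕ) →₀ A => f.sum fun j a => orderedMonomial b bar j * incl a)

section Derivation

variable {k : Type u} [Field k] {A : Type v} [Ring A] [Algebra k A]
  {G : Type w} [LieRing G] [LieAlgebra k G] {B : Type x} [Ring B] [Algebra k B]
  {ι : Type y} [LinearOrder ι] {b : Module.Basis ι k G}
  {incl : A →ₐ[k] B} {bar : G →ₗ[k] B}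

/-- The derivation `δ_g` of `A`. -/
noncomputable def IsCrossedProduct.delta (h : IsCrossedProduct b incl bar) (g : G) (r : A) : A :=
  (h.commutator_mem g r).choose

theorem IsCrossedProduct.incl_delta (h : IsCrossedProduct b incl bar) (g : G) (r : A) :
    incl (h.delta g r) = bar g * incl r - incl r * bar g :=
  (h.commutator_mem g r).choose_spec.symm

theorem IsCrossedProduct.delta_add (h : IsCrossedProduct b incl bar) (g : G) (r s : A) :
    h.delta g (r + s) = h.delta g r + h.delta g s := by
  apply h.incl_injective
  simp only [map_add, h.incl_delta]
  noncomm_ring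

theorem IsCrossedProduct.delta_smul (h : IsCrossedProduct b incl bar) (g : G) (c : k) (r : A) :
    h.delta g (c • r) = c • h.delta g r := by
  apply h.incl_injective
  simp only [map_smul, h.incl_delta, smul_sub, mul_smul_comm, smul_mul_assoc]

theorem IsCrossedProduct.delta_mul (h : IsCrossedProduct b incl bar) (g : G) (r s : A) :
    h.delta g (r * s) = h.delta g r * s + r * h.delta g s := by
  apply h.incl_injective
  simp only [map_add, map_mul, h.incl_delta]
  noncomm_ring

end Derivation

/-- The subalgebra `A[g, δ]` of `B`, generated by `A` and `ḡ`. -/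
def oreSubalgebra {k : Type u} [Field k] {A : Type v} [Ring A] [Algebra k A]
    {G : Type w} [LieRing G] [LieAlgebra k G] {B : Type x} [Ring B] [Algebra k B]
    (incl : A →ₐ[k] B) (bar : G →ₗ[k] B) (g : G) : Subalgebra k B :=
  Algebra.adjoin k (Set.range incl ∪ {bar g})

/-- An element of `A`, seen in `A[g, δ]`. -/
def oreCoeff {k : Type u} [Field k] {A : Type v} [Ring A] [Algebra k A]
    {G : Type w} [LieRing G] [LieAlgebra k G] {B : Type x} [Ring B] [Algebra k B]
    (incl : A →ₐ[k] B) (bar : G →ₗ[k] B) (g : G) (a : A) : oreSubalgebra incl bar g :=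
  ⟨incl a, Algebra.subset_adjoin (Or.inl ⟨a, rfl⟩)⟩

/-- The generator `ḡ` of `A[g, δ]`. -/
def oreGen {k : Type u} [Field k] {A : Type v} [Ring A] [Algebra k A]
    {G : Type w} [LieRing G] [LieAlgebra k G] {B : Type x} [Ring B] [Algebra k B]
    (incl : A →ₐ[k] B) (bar : G →ₗ[k] B) (g : G) : oreSubalgebra incl bar g :=
  ⟨bar g, Algebra.subset_adjoin (Or.inr rfl)⟩

/-- A row is (right) unimodular if its entries generate the whole ring as a right ideal. -/
def IsUnimodularRow {R : Type u} [Ring R] {n : ℕ} (a : Fin n → R) : Prop :=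
  ∃ c : Fin n → R, ∑ i, a i * c i = 1

/-- The principal right ideal `cR`, as a right `R`-module. -/
def principalRightIdeal {R : Type u} [Ring R] (c : R) : Submodule Rᵐᵒᵖ R :=
  Submodule.span Rᵐᵒᵖ {c}

theorem mem_principalRightIdeal {R : Type u} [Ring R] (c z : R) :
    z ∈ principalRightIdeal c ↔ ∃ d : R, z = c * d := by
  rw [principalRightIdeal, Submodule.mem_span_singleton]
  constructor
  · rintro ⟨d, rfl⟩
    exact ⟨d.unop, rfl⟩
  · rintro ⟨d, rfl⟩
    exact ⟨MulOpposite.op d, rfl⟩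

/-- A non-trivial stably free module: finitely generated and stably free, but not free.
(Right modules over `R` are modules over `Rᵐᵒᵖ`.) -/
def IsNontrivialStablyFree (R : Type u) [Ring R] (M : Type v) [AddCommGroup M] [Module R M] :
    Prop :=
  Module.Finite R M ∧ Module.IsStablyFree R M ∧ ¬ Module.Free R M

end CrossedProduct

/-! Filter `B` by degree in the `ḡ`. Interchanging factors only creates terms of lower degree, so
leading parts multiply as in a polynomial ring over `A` (`IsCrossedProduct.symbol_mul`). As `A` is a
domain, so is `B`; degrees add, and a nonzero element of `A` factors only inside `A`.

Put `y = ḡ + q` and `I = rB ∩ yB`. Since `rB + yB = B` and both ideals are free of rank one, `0 → I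
→ rB ⊕ yB → B → 0` splits, so `I ⊕ B ≅ B²`.

If `I` were free, invariant basis number would give `I = cB`. Writing `c = ye`, one gets `{z : yz ∈
rB} = eB`. The right Ore condition puts a nonzero `rz` with `z ∈ A` into `eB`, so `e ∈ A`;
degree-one coefficients of `ye ∈ rB` then give `e ∈ rA`. Hence `yz ∈ rB` forces `z ∈ rB`.

Let `d` be the commutator with `y` on `A`. As `A` is right noetherian, some `dⁿ(r)` is a right
combination of earlier iterates, so `yⁿr ∈ ∑_{i<n} yⁱrB`. Cancelling `y` repeatedly yields `yr ∈
rB`, whence `d(rA) ⊆ rA`. Reading the unimodularity relation modulo `rA` from the top coefficient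
down gives `1 ∈ rA` (`IsCrossedProduct.exists_mul_eq_one`), a contradiction. -/

namespace CrossedProduct

/-! ### The degree filtration and commutation modulo lower degree. -/

section Filtration

variable {k : Type*} [Field k] {A : Type*} [Ring A] [Algebra k A]
  {G : Type*} [LieRing G] [LieAlgebra k G] {B : Type*} [Ring B] [Algebra k B]
  {ι : Type*} [LinearOrder ι] {b : Module.Basis ι k G}
  {incl : A →ₐ[k] B} {bar : G →ₗ[k] B}

@[simp]
theorem orderedMonomial_zero (b : Module.Basis ι k G) (bar : G →ₗ[k] B) :
    orderedMonomial b bar 0 = 1 := by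
  simp [orderedMonomial]

theorem orderedMonomial_add_single (b : Module.Basis ι k G) (bar : G →ₗ[k] B)
    {j : ι →₀ ℕ} {l : ι} (hl : ∀ i ∈ j.support, l ≤ i) :
    orderedMonomial b bar (j + Finsupp.single l 1) = bar (b l) * orderedMonomial b bar j := by
  have hsupp : (j + Finsupp.single l 1).support = insert l (j.support.erase l) := by
    ext i
    by_cases h : i = l <;> simp [h, eq_comm]
  have hne : ∀ i ∈ j.support.erase l, i ≠ l := fun i hi => Finset.ne_of_mem_erase hi
  have hle : ∀ i ∈ j.support.erase l, l ≤ i := fun i hi => hl i (Finset.mem_of_mem_erase hi)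
  have key : ((j.support.erase l).sort (· ≤ ·)).map
      (fun i => bar (b i) ^ (j + Finsupp.single l 1 : ι →₀ ℕ) i) =
      ((j.support.erase l).sort (· ≤ ·)).map (fun i => bar (b i) ^ j i) := by
    refine List.map_congr_left fun i hi => ?_
    have : i ≠ l := hne i (by simpa using hi)
    simp [this]
  have hrest : orderedMonomial b bar j =
      bar (b l) ^ j l * (((j.support.erase l).sort (· ≤ ·)).map fun i => bar (b i) ^ j i).prod := by
    by_cases h : l ∈ j.support
    · have hs : j.support = insert l (j.support.erase l) := (Finset.insert_erase h).symm
      rw [orderedMonomial]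
      conv_lhs => rw [hs]
      rw [Finset.sort_insert _ hle (Finset.notMem_erase _ _)]
      simp
    · have h0 : j l = 0 := by simpa using h
      rw [Finset.erase_eq_of_notMem h, h0, pow_zero, one_mul, orderedMonomial]
  rw [hrest, orderedMonomial, hsupp, Finset.sort_insert _ hle (Finset.notMem_erase _ _),
    List.map_cons, List.prod_cons, key]
  simp [pow_succ', mul_assoc]

theorem orderedMonomial_single (b : Module.Basis ι k G) (bar : G →ₗ[k] B) (l : ι) :
    orderedMonomial b bar (Finsupp.single l 1) = bar (b l) := by
  have := orderedMonomial_add_single b bar (j := 0) (l := l) (by simp)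
  simpa using this

/-- Peeling off the smallest index, which is the leftmost factor of the monomial, drives the
inductions on degree. -/
theorem exists_eq_add_single {j : ι →₀ ℕ} (hj : j ≠ 0) :
    ∃ (j' : ι →₀ ℕ) (l : ι), j = j' + Finsupp.single l 1 ∧ ∀ i ∈ j'.support, l ≤ i := by
  have hne : j.support.Nonempty := Finsupp.support_nonempty_iff.2 hj
  refine ⟨j - Finsupp.single (j.support.min' hne) 1, j.support.min' hne, ?_, ?_⟩
  · refine (tsub_add_cancel_of_le ?_).symm
    rw [Finsupp.single_le_iff]
    exact Nat.one_le_iff_ne_zero.2 (Finsupp.mem_support_iff.1 (Finset.min'_mem _ hne))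
  · intro i hi
    refine Finset.min'_le _ _ ?_
    simp only [Finsupp.mem_support_iff, Finsupp.coe_tsub, Pi.sub_apply] at hi ⊢
    omega

/-- The additive subgroup of elements of degree less than `n` in the generators `ḡ`. -/
def degreeLT (b : Module.Basis ι k G) (incl : A →ₐ[k] B) (bar : G →ₗ[k] B) (n : ℕ) :
    AddSubgroup B :=
  AddSubgroup.closure
    {x | ∃ (j : ι →₀ ℕ) (a : A), j.degree < n ∧ x = orderedMonomial b bar j * incl a}

theorem monomial_mem_degreeLT {n : ℕ} {j : ι →₀ ℕ} (hj : j.degree < n) (a : A) :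
    orderedMonomial b bar j * incl a ∈ degreeLT b incl bar n :=
  AddSubgroup.subset_closure ⟨j, a, hj, rfl⟩

theorem orderedMonomial_mem_degreeLT {n : ℕ} {j : ι →₀ ℕ} (hj : j.degree < n) :
    orderedMonomial b bar j ∈ degreeLT b incl bar n := by
  simpa using monomial_mem_degreeLT (b := b) (incl := incl) (bar := bar) hj 1

theorem degreeLT_mono {m n : ℕ} (h : m ≤ n) :
    degreeLT b incl bar m ≤ degreeLT b incl bar n :=
  AddSubgroup.closure_mono fun _ ⟨j, a, hj, hx⟩ => ⟨j, a, hj.trans_le h, hx⟩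

/-- An additive map sends `degreeLT n` into `K` as soon as it does so for the monomials. -/
theorem map_mem_of_mem_degreeLT {C : Type*} [AddCommGroup C] {n : ℕ} (f : B →+ C)
    (K : AddSubgroup C)
    (h : ∀ (j : ι →₀ ℕ) (a : A), j.degree < n → f (orderedMonomial b bar j * incl a) ∈ K)
    {x : B} (hx : x ∈ degreeLT b incl bar n) : f x ∈ K := by
  have : degreeLT b incl bar n ≤ K.comap f :=
    (AddSubgroup.closure_le _).2 fun _ ⟨j, a, hj, hx⟩ => hx ▸ h j a hj
  exact this hx

theorem mul_incl_mem_degreeLT {n : ℕ} {x : B} (hx : x ∈ degreeLT b incl bar n) (a : A) :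
    x * incl a ∈ degreeLT b incl bar n :=
  map_mem_of_mem_degreeLT (AddMonoidHom.mulRight (incl a)) _ (fun j a' hj => by
    simpa [mul_assoc] using monomial_mem_degreeLT (b := b) (incl := incl) (bar := bar) hj (a' * a))
    hx

theorem smul_mem_degreeLT {n : ℕ} {x : B} (hx : x ∈ degreeLT b incl bar n) (c : k) :
    c • x ∈ degreeLT b incl bar n := by
  have := mul_incl_mem_degreeLT hx (algebraMap k A c)
  rwa [AlgHom.commutes, ← Algebra.commutes, ← Algebra.smul_def] at this

theorem sub_mem_degreeLT_succ_iff {n : ℕ} {x y : B} (h : x - y ∈ degreeLT b incl bar n) :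
    x ∈ degreeLT b incl bar (n + 1) ↔ y ∈ degreeLT b incl bar (n + 1) := by
  have h' := degreeLT_mono (Nat.le_succ n) h
  constructor
  · intro hx; simpa using sub_mem hx h'
  · intro hy; simpa using add_mem h' hy

theorem incl_mem_degreeLT (a : A) : incl a ∈ degreeLT b incl bar 1 := by
  simpa using monomial_mem_degreeLT (b := b) (incl := incl) (bar := bar) (j := 0)
    (n := 1) (by simp) a

theorem bar_mem_degreeLT (g : G) : bar g ∈ degreeLT b incl bar 2 := by
  have hg : g ∈ Submodule.span k (Set.range b) := by simp
  induction hg using Submodule.span_induction with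
  | mem x hx =>
    obtain ⟨i, rfl⟩ := hx
    rw [← orderedMonomial_single b bar]
    exact orderedMonomial_mem_degreeLT (by simp)
  | zero => simp
  | add x y _ _ hx hy => rw [map_add]; exact add_mem hx hy
  | smul c x _ hx => rw [map_smul]; exact smul_mem_degreeLT hx c

theorem bar_add_incl_mem_degreeLT (g : G) (q : A) :
    bar g + incl q ∈ degreeLT b incl bar 2 :=
  add_mem (bar_mem_degreeLT g) (degreeLT_mono one_le_two (incl_mem_degreeLT q))

variable (hB : IsCrossedProduct b incl bar)
include hB

/-- The two claims are proved together by strong induction on degree: moving a generator past the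
leftmost factor leaves a bracket and an element of `A`, and the latter must again be controlled
against shorter monomials. -/
theorem IsCrossedProduct.commute_modulo_degreeLT (n : ℕ) : ∀ j : ι →₀ ℕ, j.degree = n →
    (∀ a : A, incl a * orderedMonomial b bar j - orderedMonomial b bar j * incl a ∈
      degreeLT b incl bar n) ∧
    ∀ i : ι, bar (b i) * orderedMonomial b bar j -
      orderedMonomial b bar (j + Finsupp.single i 1) ∈ degreeLT b incl bar (n + 1) := by
  induction n using Nat.strong_induction_on with
  | _ n ih =>
  intro j hj
  by_cases hj0 : j = 0
  · subst hj0
    simp [orderedMonomial_single]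
  obtain ⟨j', l, rfl, hl⟩ := exists_eq_add_single hj0
  obtain ⟨m, rfl⟩ : ∃ m, n = m + 1 := ⟨j'.degree, by rw [← hj]; simp⟩
  have hj' : j'.degree = m := by simpa using hj
  -- The bound `p ≤ m + 1` keeps all monomials involved in degree below `n`, where the induction
  -- hypothesis applies.
  have left_incl : ∀ (a : A) {p : ℕ}, p ≤ m + 1 → ∀ {x : B}, x ∈ degreeLT b incl bar p →
      incl a * x ∈ degreeLT b incl bar p := by
    intro a p hp x hx
    refine map_mem_of_mem_degreeLT (AddMonoidHom.mulLeft (incl a)) _ (fun i c hi => ?_) hx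
    have h1 := mul_incl_mem_degreeLT ((ih i.degree (by omega) i rfl).1 a) c
    have h2 : orderedMonomial b bar i * incl a * incl c ∈ degreeLT b incl bar p := by
      rw [mul_assoc, ← map_mul]; exact monomial_mem_degreeLT hi _
    have := add_mem (degreeLT_mono hi.le h1) h2
    simpa [sub_mul, mul_assoc] using this
  have left_bar : ∀ (i : ι) {p : ℕ}, p ≤ m + 1 → ∀ {x : B}, x ∈ degreeLT b incl bar p →
      bar (b i) * x ∈ degreeLT b incl bar (p + 1) := by
    intro i p hp x hx
    refine map_mem_of_mem_degreeLT (AddMonoidHom.mulLeft (bar (b i))) _ (fun i' c hi => ?_) hx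
    have h1 := mul_incl_mem_degreeLT ((ih i'.degree (by omega) i' rfl).2 i) c
    have h2 := monomial_mem_degreeLT (b := b) (incl := incl) (bar := bar) (n := p + 1)
      (j := i' + Finsupp.single i 1) (by simpa using hi) c
    have := add_mem (degreeLT_mono (by omega) h1) h2
    simpa [sub_mul, mul_assoc] using this
  have left_bar' : ∀ h : G, bar h * orderedMonomial b bar j' ∈ degreeLT b incl bar (m + 2) := by
    intro h
    have hh : h ∈ Submodule.span k (Set.range b) := by simp
    induction hh using Submodule.span_induction with
    | mem x hx =>
      obtain ⟨i, rfl⟩ := hx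
      exact left_bar i le_rfl (orderedMonomial_mem_degreeLT (by omega))
    | zero => simp
    | add x y _ _ hx hy => rw [map_add, add_mul]; exact add_mem hx hy
    | smul c x _ hx => rw [map_smul, smul_mul_assoc]; exact smul_mem_degreeLT hx c
  have hmon := orderedMonomial_add_single b bar hl
  constructor
  · intro a
    obtain ⟨d, hd⟩ := hB.commutator_mem (b l) a
    have h1 := left_bar l (Nat.le_succ m) ((ih m (Nat.lt_succ_self m) j' hj').1 a)
    have h2 : incl d * orderedMonomial b bar j' ∈ degreeLT b incl bar (m + 1) :=
      left_incl d le_rfl (orderedMonomial_mem_degreeLT (by omega))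
    have := sub_mem h1 h2
    rw [hmon]
    convert this using 1
    rw [← hd]
    noncomm_ring
  · intro i
    -- If `i ≤ l`, the product is already ordered. Otherwise `ḡᵢ` is exchanged with `ḡₗ` by the
    -- bracket relation and the induction hypothesis is used behind `ḡₗ`.
    by_cases hil : i ≤ l
    · rw [orderedMonomial_add_single b bar (l := i) (j := j' + Finsupp.single l 1), sub_self]
      · exact zero_mem _
      · intro i' hi'
        rcases Finset.mem_union.1 (Finsupp.support_add hi') with h | h
        · exact hil.trans (hl i' h)
        · rw [Finset.mem_singleton.1 (Finsupp.support_single_subset h)]; exact hil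
    · have hli : l ≤ i := (not_le.1 hil).le
      have hcomm : j' + Finsupp.single l 1 + Finsupp.single i 1 =
          j' + Finsupp.single i 1 + Finsupp.single l 1 := add_right_comm _ _ _
      have hmon' : orderedMonomial b bar (j' + Finsupp.single i 1 + Finsupp.single l 1) =
          bar (b l) * orderedMonomial b bar (j' + Finsupp.single i 1) := by
        refine orderedMonomial_add_single b bar ?_
        intro i' hi'
        rcases Finset.mem_union.1 (Finsupp.support_add hi') with h | h
        · exact hl i' h
        · rw [Finset.mem_singleton.1 (Finsupp.support_single_subset h)]; exact hli
      obtain ⟨a, ha⟩ := hB.bracket_mod (b i) (b l)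
      have h1 := left_bar l le_rfl ((ih m (Nat.lt_succ_self m) j' hj').2 i)
      have h2 := left_bar' ⁅b i, b l⁆
      have h3 : incl a * orderedMonomial b bar j' ∈ degreeLT b incl bar (m + 2) :=
        degreeLT_mono (Nat.le_succ _)
          (left_incl a le_rfl (orderedMonomial_mem_degreeLT (by omega)))
      have := add_mem h1 (add_mem h2 h3)
      rw [hcomm, hmon', hmon]
      convert this using 1
      rw [← add_mul, ← ha]
      noncomm_ring

theorem IsCrossedProduct.incl_mul_mem_degreeLT (a : A) {n : ℕ} {x : B}
    (hx : x ∈ degreeLT b incl bar n) : incl a * x ∈ degreeLT b incl bar n := by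
  refine map_mem_of_mem_degreeLT (AddMonoidHom.mulLeft (incl a)) _ (fun i c hi => ?_) hx
  have h1 := mul_incl_mem_degreeLT ((hB.commute_modulo_degreeLT _ i rfl).1 a) c
  have h2 : orderedMonomial b bar i * incl a * incl c ∈ degreeLT b incl bar n := by
    rw [mul_assoc, ← map_mul]; exact monomial_mem_degreeLT hi _
  have := add_mem (degreeLT_mono hi.le h1) h2
  simpa [sub_mul, mul_assoc] using this

theorem IsCrossedProduct.bar_mul_mem_degreeLT (i : ι) {n : ℕ} {x : B}
    (hx : x ∈ degreeLT b incl bar n) : bar (b i) * x ∈ degreeLT b incl bar (n + 1) := by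
  refine map_mem_of_mem_degreeLT (AddMonoidHom.mulLeft (bar (b i))) _ (fun i' c hi => ?_) hx
  have h1 := mul_incl_mem_degreeLT ((hB.commute_modulo_degreeLT _ i' rfl).2 i) c
  have h2 := monomial_mem_degreeLT (b := b) (incl := incl) (bar := bar) (n := n + 1)
    (j := i' + Finsupp.single i 1) (by simpa using hi) c
  have := add_mem (degreeLT_mono (by omega) h1) h2
  simpa [sub_mul, mul_assoc] using this

theorem IsCrossedProduct.orderedMonomial_mul (i : ι →₀ ℕ) :
    (∀ {n : ℕ} {x : B}, x ∈ degreeLT b incl bar n →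
      orderedMonomial b bar i * x ∈ degreeLT b incl bar (i.degree + n)) ∧
    ∀ j : ι →₀ ℕ, orderedMonomial b bar i * orderedMonomial b bar j -
      orderedMonomial b bar (i + j) ∈ degreeLT b incl bar (i.degree + j.degree) := by
  induction hm : i.degree generalizing i with
  | zero =>
    obtain rfl : i = 0 := (Finsupp.degree_eq_zero_iff i).1 hm
    simp
  | succ m ih =>
    obtain ⟨i', l, rfl, hl⟩ := exists_eq_add_single (j := i) (by rintro rfl; simp at hm)
    have hi' : i'.degree = m := by simpa using hm
    obtain ⟨ih1, ih2⟩ := ih i' hi'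
    rw [orderedMonomial_add_single b bar hl]
    constructor
    · intro n x hx
      rw [mul_assoc, show m + 1 + n = m + n + 1 by omega]
      exact hB.bar_mul_mem_degreeLT l (ih1 hx)
    · intro j
      have h1 := hB.bar_mul_mem_degreeLT l (ih2 j)
      have h2 := (hB.commute_modulo_degreeLT _ (i' + j) rfl).2 l
      rw [map_add, hi', add_right_comm] at h2
      rw [add_right_comm] at h1
      have := add_mem h1 h2
      rw [add_right_comm i' _ j]
      convert this using 1
      noncomm_ring

theorem IsCrossedProduct.monomial_mul_monomial (i j : ι →₀ ℕ) (a c : A) :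
    orderedMonomial b bar i * incl a * (orderedMonomial b bar j * incl c) -
      orderedMonomial b bar (i + j) * incl (a * c) ∈
        degreeLT b incl bar (i.degree + j.degree) := by
  have h1 := mul_incl_mem_degreeLT ((hB.orderedMonomial_mul i).1
    ((hB.commute_modulo_degreeLT _ j rfl).1 a)) c
  have h2 := mul_incl_mem_degreeLT ((hB.orderedMonomial_mul i).2 j) (a * c)
  have := add_mem h1 h2
  convert this using 1
  rw [map_mul]
  noncomm_ring

end Filtration

end CrossedProduct

namespace CrossedProduct

/-! ### Leading symbols and their multiplicativity. -/

section Symbol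

variable {k : Type*} [Field k] {A : Type*} [Ring A] [Algebra k A]
  {G : Type*} [LieRing G] [LieAlgebra k G] {B : Type*} [Ring B] [Algebra k B]
  {ι : Type*} [LinearOrder ι] {b : Module.Basis ι k G}
  {incl : A →ₐ[k] B} {bar : G →ₗ[k] B}

/-- The coordinates of an element of `B` in the basis of ordered monomials. -/
noncomputable def IsCrossedProduct.coords (hB : IsCrossedProduct b incl bar) :
    B ≃+ ((ι →₀ ℕ) →₀ A) :=
  (AddEquiv.ofBijective (Finsupp.liftAddHom fun j : ι →₀ ℕ =>
    (AddMonoidHom.mulLeft (orderedMonomial b bar j)).comp (incl : A →+* B).toAddMonoidHom)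
    hB.monomial_basis).symm

/-- The homogeneous component of degree `n`, as a polynomial with coefficients in `A`. -/
noncomputable def IsCrossedProduct.symbol (hB : IsCrossedProduct b incl bar) (n : ℕ) :
    B →+ AddMonoidAlgebra A (ι →₀ ℕ) :=
  AddMonoidAlgebra.coeffAddEquiv.symm.toAddMonoidHom.comp
    ((Finsupp.filterAddHom fun j : ι →₀ ℕ => j.degree = n).comp hB.coords.toAddMonoidHom)

variable (hB : IsCrossedProduct b incl bar)
include hB

theorem IsCrossedProduct.coords_symm_apply (f : (ι →₀ ℕ) →₀ A) :
    hB.coords.symm f = f.sum fun j a => orderedMonomial b bar j * incl a := rfl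

theorem IsCrossedProduct.coords_monomial (j : ι →₀ ℕ) (a : A) :
    hB.coords (orderedMonomial b bar j * incl a) = Finsupp.single j a := by
  rw [← AddEquiv.eq_symm_apply, hB.coords_symm_apply, Finsupp.sum_single_index (by simp)]

theorem IsCrossedProduct.symbol_apply (n : ℕ) (x : B) :
    hB.symbol n x = .ofCoeff ((hB.coords x).filter fun j => j.degree = n) := rfl

theorem IsCrossedProduct.symbol_monomial (n : ℕ) (j : ι →₀ ℕ) (a : A) :
    hB.symbol n (orderedMonomial b bar j * incl a) =
      if j.degree = n then AddMonoidAlgebra.single j a else 0 := by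
  rw [hB.symbol_apply, hB.coords_monomial]
  split_ifs with h
  · rw [Finsupp.filter_single_of_pos (p := fun j : ι →₀ ℕ => j.degree = n) h]; rfl
  · rw [Finsupp.filter_single_of_neg (p := fun j : ι →₀ ℕ => j.degree = n) h]; rfl

theorem IsCrossedProduct.mem_degreeLT_iff {n : ℕ} {x : B} :
    x ∈ degreeLT b incl bar n ↔ ∀ j, hB.coords x j ≠ 0 → j.degree < n := by
  constructor
  · intro hx j
    contrapose!
    intro hj
    have := map_mem_of_mem_degreeLT ((Finsupp.applyAddHom j).comp hB.coords.toAddMonoidHom) ⊥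
      (fun i a hi => ?_) hx
    · simpa using this
    · have : i ≠ j := by rintro rfl; omega
      simp [hB.coords_monomial, this]
  · intro h
    rw [← hB.coords.symm_apply_apply x, hB.coords_symm_apply]
    exact sum_mem fun j hj => monomial_mem_degreeLT (h j (Finsupp.mem_support_iff.1 hj)) _

theorem IsCrossedProduct.symbol_eq_zero {n : ℕ} {x : B} (hx : x ∈ degreeLT b incl bar n) :
    hB.symbol n x = 0 := by
  rw [hB.symbol_apply, AddMonoidAlgebra.ofCoeff_eq_zero, Finsupp.filter_eq_zero_iff]
  intro j hj
  by_contra h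
  exact (hB.mem_degreeLT_iff.1 hx j h).ne hj

theorem IsCrossedProduct.mem_degreeLT_of_symbol_eq_zero {n : ℕ} {x : B}
    (hx : x ∈ degreeLT b incl bar (n + 1)) (h : hB.symbol n x = 0) :
    x ∈ degreeLT b incl bar n := by
  rw [hB.symbol_apply, AddMonoidAlgebra.ofCoeff_eq_zero, Finsupp.filter_eq_zero_iff] at h
  refine hB.mem_degreeLT_iff.2 fun j hj => ?_
  have h1 := hB.mem_degreeLT_iff.1 hx j hj
  have h2 : j.degree ≠ n := fun h' => hj (h j h')
  omega

theorem IsCrossedProduct.exists_mem_degreeLT (x : B) : ∃ n, x ∈ degreeLT b incl bar n := by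
  refine ⟨(hB.coords x).support.sup Finsupp.degree + 1, hB.mem_degreeLT_iff.2 fun j hj => ?_⟩
  exact Nat.lt_succ_of_le (Finset.le_sup (f := Finsupp.degree) (Finsupp.mem_support_iff.2 hj))

theorem IsCrossedProduct.exists_symbol_ne_zero {x : B} (hx : x ≠ 0) :
    ∃ n, x ∈ degreeLT b incl bar (n + 1) ∧ hB.symbol n x ≠ 0 := by
  classical
  have hex := hB.exists_mem_degreeLT x
  obtain ⟨n, hn⟩ : ∃ n, Nat.find hex = n + 1 := by
    -- The bound defining the filtration is strict, so level `0` is zero and degree `n` corresponds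
    -- to level `n + 1`.
    refine Nat.exists_eq_succ_of_ne_zero fun h0 => hx ?_
    have h1 := hB.mem_degreeLT_iff.1 (h0 ▸ Nat.find_spec hex)
    refine hB.coords.map_eq_zero_iff.1 (Finsupp.ext fun j => ?_)
    by_contra h
    exact absurd (h1 j h) (Nat.not_lt_zero _)
  refine ⟨n, hn ▸ Nat.find_spec hex, fun h0 => ?_⟩
  exact Nat.find_min hex (m := n) (by omega)
    (hB.mem_degreeLT_of_symbol_eq_zero (hn ▸ Nat.find_spec hex) h0)

theorem IsCrossedProduct.symbol_zero_incl (a : A) :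
    hB.symbol 0 (incl a) = AddMonoidAlgebra.single 0 a := by
  simpa using hB.symbol_monomial 0 0 a

theorem IsCrossedProduct.mem_range_of_mem_degreeLT_one {x : B}
    (hx : x ∈ degreeLT b incl bar 1) : ∃ a, x = incl a := by
  have h := hB.mem_degreeLT_iff.1 hx
  refine ⟨hB.coords x 0, ?_⟩
  apply hB.coords.injective
  have := hB.coords_monomial 0 (hB.coords x 0)
  rw [orderedMonomial_zero, one_mul] at this
  rw [this]
  ext j
  by_cases hj : j = 0
  · simp [hj]
  · rw [Finsupp.single_eq_of_ne hj]
    by_contra h'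
    exact hj ((Finsupp.degree_eq_zero_iff j).1 (Nat.lt_one_iff.1 (h j h')))

/-- Symbols are multiplicative. -/
theorem IsCrossedProduct.symbol_mul {m n : ℕ} {x y : B}
    (hx : x ∈ degreeLT b incl bar (m + 1)) (hy : y ∈ degreeLT b incl bar (n + 1)) :
    x * y ∈ degreeLT b incl bar (m + n + 1) ∧
      hB.symbol (m + n) (x * y) = hB.symbol m x * hB.symbol n y := by
  have key : ∀ (i j : ι →₀ ℕ) (a c : A), i.degree < m + 1 → j.degree < n + 1 →
      orderedMonomial b bar i * incl a * (orderedMonomial b bar j * incl c) ∈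
        degreeLT b incl bar (m + n + 1) ∧
      hB.symbol (m + n) (orderedMonomial b bar i * incl a * (orderedMonomial b bar j * incl c)) =
        hB.symbol m (orderedMonomial b bar i * incl a) *
          hB.symbol n (orderedMonomial b bar j * incl c) := by
    intro i j a c hi hj
    have h := degreeLT_mono (show i.degree + j.degree ≤ m + n by omega)
      (hB.monomial_mul_monomial i j a c)
    refine ⟨(sub_mem_degreeLT_succ_iff h).2 (monomial_mem_degreeLT (by simp; omega) _), ?_⟩
    have h0 := hB.symbol_eq_zero h
    rw [map_sub, sub_eq_zero] at h0
    rw [h0]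
    simp only [hB.symbol_monomial, map_add]
    by_cases h1 : i.degree = m
    · by_cases h2 : j.degree = n
      · simp [h1, h2, AddMonoidAlgebra.single_mul_single]
      · rw [if_neg (by omega), if_neg h2, mul_zero]
    · rw [if_neg (by omega), if_neg h1, zero_mul]
  have hmem : ∀ (j : ι →₀ ℕ) (c : A), j.degree < n + 1 →
      x * (orderedMonomial b bar j * incl c) ∈ degreeLT b incl bar (m + n + 1) := fun j c hj =>
    map_mem_of_mem_degreeLT (AddMonoidHom.mulRight (orderedMonomial b bar j * incl c)) _
      (fun i a hi => (key i j a c hi hj).1) hx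
  refine ⟨map_mem_of_mem_degreeLT (AddMonoidHom.mulLeft x) _ hmem hy, ?_⟩
  have hsym : ∀ (j : ι →₀ ℕ) (c : A), j.degree < n + 1 →
      hB.symbol (m + n) (x * (orderedMonomial b bar j * incl c)) =
        hB.symbol m x * hB.symbol n (orderedMonomial b bar j * incl c) := by
    intro j c hj
    have := map_mem_of_mem_degreeLT ((hB.symbol (m + n)).comp
        (AddMonoidHom.mulRight (orderedMonomial b bar j * incl c)) -
      (AddMonoidHom.mulRight (hB.symbol n (orderedMonomial b bar j * incl c))).comp
        (hB.symbol m)) ⊥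
      (fun i a hi => by simpa [sub_eq_zero] using (key i j a c hi hj).2) hx
    simpa [sub_eq_zero] using this
  have := map_mem_of_mem_degreeLT ((hB.symbol (m + n)).comp (AddMonoidHom.mulLeft x) -
      (AddMonoidHom.mulLeft (hB.symbol m x)).comp (hB.symbol n)) ⊥
      (fun j c hj => by simpa [sub_eq_zero] using hsym j c hj) hy
  simpa [sub_eq_zero] using this

theorem IsCrossedProduct.symbol_pow {x : B} (hx : x ∈ degreeLT b incl bar 2) (n : ℕ) :
    x ^ n ∈ degreeLT b incl bar (n + 1) ∧ hB.symbol n (x ^ n) = hB.symbol 1 x ^ n := by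
  induction n with
  | zero =>
    have h1 := incl_mem_degreeLT (b := b) (incl := incl) (bar := bar) 1
    have h2 := hB.symbol_zero_incl 1
    rw [map_one] at h1 h2
    simpa using ⟨h1, h2⟩
  | succ n ih =>
    have := hB.symbol_mul ih.1 hx
    rw [pow_succ, pow_succ, ← ih.2]
    exact this

section Domain

variable [IsDomain A]

theorem IsCrossedProduct.symbol_mul_ne_zero {m n : ℕ} {x y : B}
    (hx : x ∈ degreeLT b incl bar (m + 1)) (hy : y ∈ degreeLT b incl bar (n + 1))
    (hx0 : hB.symbol m x ≠ 0) (hy0 : hB.symbol n y ≠ 0) : hB.symbol (m + n) (x * y) ≠ 0 := by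
  rw [(hB.symbol_mul hx hy).2]
  exact mul_ne_zero hx0 hy0

theorem IsCrossedProduct.noZeroDivisors : NoZeroDivisors B where
  eq_zero_or_eq_zero_of_mul_eq_zero {x y} h := by
    by_contra! hxy
    obtain ⟨m, hm, hm0⟩ := hB.exists_symbol_ne_zero hxy.1
    obtain ⟨n, hn, hn0⟩ := hB.exists_symbol_ne_zero hxy.2
    exact hB.symbol_mul_ne_zero hm hn hm0 hn0 (by rw [h, map_zero])

/-- If a product is a nonzero element of `A`, then both factors lie in `A`. -/
theorem IsCrossedProduct.factors_of_mul_eq_incl {x y : B} {a : A} (ha : a ≠ 0)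
    (h : x * y = incl a) : (∃ c, x = incl c) ∧ ∃ d, y = incl d := by
  have hne : incl a ≠ 0 := (map_ne_zero_iff incl hB.incl_injective).2 ha
  obtain ⟨m, hm, hm0⟩ := hB.exists_symbol_ne_zero (x := x) (by rintro rfl; simp at h; exact hne h.symm)
  obtain ⟨n, hn, hn0⟩ := hB.exists_symbol_ne_zero (x := y) (by rintro rfl; simp at h; exact hne h.symm)
  have h0 := hB.symbol_mul_ne_zero hm hn hm0 hn0
  rw [h] at h0
  -- Degrees add, and the product has degree zero.
  have : m + n = 0 := by
    by_contra hmn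
    exact h0 (hB.symbol_eq_zero (degreeLT_mono (by omega) (incl_mem_degreeLT a)))
  obtain ⟨rfl, rfl⟩ : m = 0 ∧ n = 0 := by omega
  exact ⟨hB.mem_range_of_mem_degreeLT_one hm, hB.mem_range_of_mem_degreeLT_one hn⟩

end Domain

/-- The symbol of `ḡ` is a linear form with coefficients in the field `k`, so any nonzero one can be
inverted when coefficients are compared. -/
theorem IsCrossedProduct.coeff_symbol_one_bar (g : G) (i : ι) :
    (hB.symbol 1 (bar g)).coeff (Finsupp.single i 1) = algebraMap k A (b.repr g i) := by
  have hg : bar g = (b.repr g).sum fun l c =>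
      orderedMonomial b bar (Finsupp.single l 1) * incl (algebraMap k A c) := by
    conv_lhs => rw [← b.linearCombination_repr g, Finsupp.linearCombination_apply]
    rw [map_finsuppSum]
    refine Finsupp.sum_congr fun l _ => ?_
    rw [map_smul, orderedMonomial_single, AlgHom.commutes, ← Algebra.commutes, Algebra.smul_def]
  rw [hg, map_finsuppSum, AddMonoidAlgebra.coeff_finsuppSum, Finsupp.sum, Finsupp.finsetSum_apply]
  simp only [hB.symbol_monomial, Finsupp.degree_single, if_true, AddMonoidAlgebra.coeff_single]
  rw [Finset.sum_eq_single i]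
  · simp
  · intro l _ hl
    rw [Finsupp.single_eq_of_ne]
    intro h
    exact hl ((Finsupp.single_left_inj one_ne_zero).1 h).symm
  · intro h
    simp [Finsupp.notMem_support_iff.1 h]

theorem IsCrossedProduct.symbol_one_bar_add_incl (g : G) (q : A) :
    hB.symbol 1 (bar g + incl q) = hB.symbol 1 (bar g) := by
  rw [map_add, hB.symbol_eq_zero (incl_mem_degreeLT q), add_zero]

variable [IsDomain A]

theorem IsCrossedProduct.symbol_one_bar_ne_zero {g : G} (hg : g ≠ 0) :
    hB.symbol 1 (bar g) ≠ 0 := by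
  intro h
  obtain ⟨i, hi⟩ : ∃ i, b.repr g i ≠ 0 := by
    by_contra! h0
    exact hg (b.repr.map_eq_zero_iff.1 (Finsupp.ext h0))
  have := hB.coeff_symbol_one_bar g i
  rw [h] at this
  exact hi ((map_eq_zero (algebraMap k A)).1 (by simpa using this.symm))

/-- If `r B` contains `a ḡ` up to an element of `A`, then `a ∈ r A`. -/
theorem IsCrossedProduct.exists_eq_mul_of_mul_bar {g : G} (hg : g ≠ 0) {q r a a' : A} {x : B}
    (hr : r ≠ 0) (h : incl r * x = incl a * (bar g + incl q) + incl a') : ∃ c, a = r * c := by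
  by_cases ha : a = 0
  · exact ⟨0, by simp [ha]⟩
  have hsym : ∀ {s : A} {n : ℕ} {z : B}, z ∈ degreeLT b incl bar (n + 1) →
      hB.symbol n (incl s * z) = AddMonoidAlgebra.single 0 s * hB.symbol n z := by
    intro s n z hz
    have := (hB.symbol_mul (m := 0) (incl_mem_degreeLT s) hz).2
    rwa [zero_add, hB.symbol_zero_incl] at this
  have hrhs : incl a * (bar g + incl q) + incl a' ∈ degreeLT b incl bar 2 :=
    add_mem (hB.incl_mul_mem_degreeLT a (bar_add_incl_mem_degreeLT g q))
      (degreeLT_mono one_le_two (incl_mem_degreeLT a'))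
  -- Left multiplication by the nonzero `r` preserves degree, so `x` has degree at most one.
  have hx2 : x ∈ degreeLT b incl bar 2 := by
    by_cases hx : x = 0
    · rw [hx]; exact zero_mem _
    obtain ⟨n, hn, hn0⟩ := hB.exists_symbol_ne_zero hx
    by_cases hn1 : n ≤ 1
    · exact degreeLT_mono (by omega) hn
    · exfalso
      have h1 : hB.symbol n (incl r * x) = 0 := by
        rw [h]; exact hB.symbol_eq_zero (degreeLT_mono (by omega) hrhs)
      rw [hsym hn] at h1
      exact mul_ne_zero (AddMonoidAlgebra.single_ne_zero.2 hr) hn0 h1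
  have h1 := congrArg (hB.symbol 1) h
  rw [hsym hx2, map_add, hsym (bar_add_incl_mem_degreeLT g q), hB.symbol_one_bar_add_incl,
    hB.symbol_eq_zero (incl_mem_degreeLT a'), add_zero] at h1
  obtain ⟨i, hi⟩ : ∃ i, b.repr g i ≠ 0 := by
    by_contra! h0
    exact hg (b.repr.map_eq_zero_iff.1 (Finsupp.ext h0))
  have h2 := congrArg (fun p => p.coeff (Finsupp.single i 1)) h1
  simp only [AddMonoidAlgebra.coeff_single_zero_mul, hB.coeff_symbol_one_bar] at h2
  refine ⟨(hB.symbol 1 x).coeff (Finsupp.single i 1) * algebraMap k A (b.repr g i)⁻¹, ?_⟩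
  rw [← mul_assoc, h2, mul_assoc, ← map_mul, mul_inv_cancel₀ hi, map_one, mul_one]

/-- The powers of `ḡ + q` are left linearly independent over `A`. -/
theorem IsCrossedProduct.eq_zero_of_sum_mul_pow {g : G} (hg : g ≠ 0) {q : A} {f : ℕ →₀ A}
    (h : (f.sum fun n a => incl a * (bar g + incl q) ^ n) = 0) : f = 0 := by
  by_contra hf
  have hne := Finsupp.support_nonempty_iff.2 hf
  set n := f.support.max' hne
  have hn : n ∈ f.support := Finset.max'_mem _ hne
  have hy := hB.symbol_pow (bar_add_incl_mem_degreeLT g q)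
  have h1 := congrArg (hB.symbol n) h
  -- Only the term with the largest exponent `n` contributes in degree `n`.
  rw [Finsupp.sum, map_sum, Finset.sum_eq_single n] at h1
  · have h2 := hB.symbol_mul_ne_zero (m := 0) (incl_mem_degreeLT (f n)) (hy n).1
      (by
        rw [hB.symbol_zero_incl]
        exact AddMonoidAlgebra.single_ne_zero.2 (Finsupp.mem_support_iff.1 hn))
      (by
        rw [(hy n).2, hB.symbol_one_bar_add_incl]
        exact pow_ne_zero _ (hB.symbol_one_bar_ne_zero hg))
    rw [zero_add, h1] at h2
    exact h2 (map_zero _)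
  · intro m hm hmn
    have hlt : m < n := lt_of_le_of_ne (Finset.le_max' _ _ hm) hmn
    exact hB.symbol_eq_zero
      (degreeLT_mono hlt (hB.incl_mul_mem_degreeLT (f m) (hy m).1))
  · intro h'; exact absurd hn h'

end Symbol

end CrossedProduct

namespace CrossedProduct

/-! ### Splitting, stable freeness and rank. -/

section Module

/-- If `P + Q` is a projective module, then `(P ∩ Q) ⊕ (P + Q) ≃ P ⊕ Q`. -/
theorem nonempty_inf_prod_equiv {R N : Type*} [Ring R] [AddCommGroup N] [Module R N]
    [Module.Projective R N] (P Q : Submodule R N) (h : P ⊔ Q = ⊤) :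
    Nonempty (((P ⊓ Q : Submodule R N) × N) ≃ₗ[R] (P × Q)) := by
  let f : (P × Q) →ₗ[R] N := P.subtype.coprod Q.subtype
  have hf : Function.Surjective f := by
    intro x
    obtain ⟨p, hp, q, hq, rfl⟩ := Submodule.mem_sup.1 (h ▸ Submodule.mem_top : x ∈ P ⊔ Q)
    exact ⟨(⟨p, hp⟩, ⟨q, hq⟩), rfl⟩
  obtain ⟨s, hs⟩ := Module.projective_lifting_property f LinearMap.id hf
  have hs' : ∀ x, f (s x) = x := fun x => LinearMap.congr_fun hs x
  -- The antidiagonal `m ↦ (m, -m)` identifies `P ∩ Q` with the kernel of `f`; the section `s`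
  -- supplies the complement.
  let j : (P ⊓ Q : Submodule R N) →ₗ[R] (P × Q) :=
    (Submodule.inclusion inf_le_left).prod (-Submodule.inclusion inf_le_right)
  have hj : ∀ m, f (j m) = 0 := fun m => by simp [f, j]
  refine ⟨LinearEquiv.ofBijective (j.coprod s) ⟨?_, ?_⟩⟩
  · rw [← LinearMap.ker_eq_bot, LinearMap.ker_eq_bot']
    rintro ⟨m, x⟩ hmx
    have hmx' : j m + s x = 0 := hmx
    have hx : x = 0 := by
      have := congrArg f hmx'
      simpa [hj, hs'] using this
    subst hx
    rw [map_zero, add_zero] at hmx'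
    have : m = 0 := by
      have := congrArg (fun z : P × Q => (z.1 : N)) hmx'
      exact Subtype.ext this
    rw [this]; rfl
  · intro z
    have hz : f (z - s (f z)) = 0 := by rw [map_sub, hs', sub_self]
    set w := z - s (f z) with hw
    have hw0 : (w.1 : N) + w.2 = 0 := hz
    have hmem : (w.1 : N) ∈ P ⊓ Q :=
      ⟨w.1.2, by rw [eq_neg_of_add_eq_zero_left hw0]; exact neg_mem w.2.2⟩
    refine ⟨(⟨w.1, hmem⟩, f z), ?_⟩
    change j ⟨w.1, hmem⟩ + s (f z) = z
    rw [← eq_sub_iff_add_eq, ← hw]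
    refine Prod.ext (Subtype.ext rfl) (Subtype.ext ?_)
    simp only [j, LinearMap.prod_apply, Function.prod_apply, LinearMap.neg_apply, Submodule.coe_neg,
      Submodule.coe_inclusion]
    exact (eq_neg_of_add_eq_zero_right hw0).symm

variable {B : Type*} [Ring B]

/-- The right module `cB` is free on `c` if `c` is left regular. -/
noncomputable def principalEquiv (c : B) (hc : ∀ x, c * x = 0 → x = 0) :
    Bᵐᵒᵖ ≃ₗ[Bᵐᵒᵖ] principalRightIdeal c :=
  LinearEquiv.ofBijective ((LinearMap.toSpanSingleton Bᵐᵒᵖ B c).codRestrict _ fun x =>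
    Submodule.smul_mem _ x (Submodule.mem_span_singleton_self c)) (by
    constructor
    · rw [← LinearMap.ker_eq_bot, LinearMap.ker_eq_bot']
      intro x hx
      have : c * x.unop = 0 := congrArg Subtype.val hx
      exact MulOpposite.unop_injective (hc _ this)
    · rintro ⟨z, hz⟩
      obtain ⟨d, rfl⟩ := (mem_principalRightIdeal c z).1 hz
      exact ⟨MulOpposite.op d, rfl⟩)

/-- A ring is free of rank one as a right module over itself. -/
noncomputable def rightRegularEquiv (B : Type*) [Ring B] : Bᵐᵒᵖ ≃ₗ[Bᵐᵒᵖ] B :=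
  LinearEquiv.ofBijective (LinearMap.toSpanSingleton Bᵐᵒᵖ B 1) (by
    constructor
    · rw [← LinearMap.ker_eq_bot, LinearMap.ker_eq_bot']
      intro x hx
      have : (1 : B) * x.unop = 0 := hx
      exact MulOpposite.unop_injective (by simpa using this)
    · intro z
      exact ⟨MulOpposite.op z, one_mul z⟩)

theorem nonempty_inf_prod_equiv_of_unimodular {c d s t : B} (hc : ∀ x, c * x = 0 → x = 0)
    (hd : ∀ x, d * x = 0 → x = 0) (h : c * s + d * t = 1) :
    Nonempty (((principalRightIdeal c ⊓ principalRightIdeal d : Submodule Bᵐᵒᵖ B) × Bᵐᵒᵖ)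
      ≃ₗ[Bᵐᵒᵖ] (Bᵐᵒᵖ × Bᵐᵒᵖ)) := by
  have : Module.Projective Bᵐᵒᵖ B := Module.Projective.of_equiv (rightRegularEquiv B)
  have htop : principalRightIdeal c ⊔ principalRightIdeal d = ⊤ := by
    refine eq_top_iff.2 fun x _ => ?_
    have hx : x = c * (s * x) + d * (t * x) := by
      rw [← mul_assoc, ← mul_assoc, ← add_mul, h, one_mul]
    rw [hx]
    exact Submodule.add_mem_sup ((mem_principalRightIdeal _ _).2 ⟨_, rfl⟩)
      ((mem_principalRightIdeal _ _).2 ⟨_, rfl⟩)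
  obtain ⟨e⟩ := nonempty_inf_prod_equiv _ _ htop
  exact ⟨((LinearEquiv.refl _ _).prodCongr (rightRegularEquiv B)).trans
    (e.trans ((principalEquiv c hc).symm.prodCongr (principalEquiv d hd).symm))⟩

theorem finite_and_isStablyFree_of_prod_equiv {R M : Type*} [Ring R] [AddCommGroup M] [Module R M]
    (e : (M × R) ≃ₗ[R] (R × R)) : Module.Finite R M ∧ Module.IsStablyFree R M := by
  have hfree : Module.Free R (M × R) := Module.Free.of_equiv e.symm
  refine ⟨Module.Finite.of_surjective ((LinearMap.fst R M R).comp e.symm.toLinearMap) ?_,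
    Module.IsStablyFree.of_free_prod R M R⟩
  exact Prod.fst_surjective.comp e.symm.surjective

/-- A free module `M` with `M ⊕ R ≃ R ⊕ R` is cyclic. -/
theorem exists_span_singleton_eq_top {R M : Type*} [Ring R] [InvariantBasisNumber R]
    [AddCommGroup M] [Module R M] [Module.Free R M] (e : (M × R) ≃ₗ[R] (R × R)) :
    ∃ c : M, Submodule.span R {c} = ⊤ := by
  rcases subsingleton_or_nontrivial R with hR | hR
  · have := Module.subsingleton R M
    exact ⟨0, Subsingleton.elim _ _⟩
  let u := Module.Free.chooseBasis R M
  let v : Module.Basis Unit R R := Module.Basis.singleton Unit R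
  let σ := (u.prod v).indexEquiv ((v.prod v).map e.symm)
  -- A basis of `M` plus one element is equinumerous with two elements; finiteness has to come first
  -- for `Nat.card` to be additive.
  have hcard : Nat.card (Module.Free.ChooseBasisIndex R M) = 1 := by
    have hfin : Finite (Module.Free.ChooseBasisIndex R M ⊕ Unit) := Finite.of_equiv _ σ.symm
    have : Finite (Module.Free.ChooseBasisIndex R M) :=
      Finite.of_injective (Sum.inl : _ → Module.Free.ChooseBasisIndex R M ⊕ Unit) Sum.inl_injective
    have := Nat.card_congr σ
    rw [Nat.card_sum, Nat.card_sum] at this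
    simpa using this
  obtain ⟨hsub, ⟨i⟩⟩ := Nat.card_eq_one_iff_unique.1 hcard
  refine ⟨u i, ?_⟩
  rw [← u.span_eq]
  congr 1
  ext x
  constructor
  · rintro rfl; exact ⟨i, rfl⟩
  · rintro ⟨i', rfl⟩; rw [Subsingleton.elim i' i]; rfl

end Module

/-! ### Consequences of the right noetherian condition. -/

section RightNoetherian

variable {A : Type*} [Ring A] [IsNoetherianRing Aᵐᵒᵖ]

/-- The right Ore condition in a right noetherian domain. -/
theorem exists_mul_eq_mul [IsDomain A] {r : A} (hr : r ≠ 0) (s : A) :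
    ∃ z w : A, z ≠ 0 ∧ s * z = r * w := by
  -- Two independent elements cannot exist in a module of rank one, by the strong rank condition for
  -- noetherian rings.
  have hli : ¬ LinearIndependent Aᵐᵒᵖ ![MulOpposite.op r, MulOpposite.op s] := by
    intro h
    have := h.fintype_card_le_finrank
    simp at this
  rw [LinearIndependent.pair_iff] at hli
  push Not at hli
  obtain ⟨x, z, h, h0⟩ := hli
  have h' : r * x.unop + s * z.unop = 0 := congrArg MulOpposite.unop h
  refine ⟨z.unop, -x.unop, ?_, ?_⟩
  · intro hz
    rw [hz, mul_zero, add_zero] at h'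
    exact h0 (MulOpposite.unop_injective ((mul_eq_zero.1 h').resolve_left hr))
      (MulOpposite.unop_injective hz)
  · rw [mul_neg]; exact eq_neg_of_add_eq_zero_right h'

/-- In a right noetherian ring, some term of a sequence is a right combination of earlier terms. -/
theorem exists_mem_span_lt (f : ℕ → A) :
    ∃ n, f n ∈ Submodule.span Aᵐᵒᵖ (f '' Set.Iio n) := by
  have : IsNoetherian Aᵐᵒᵖ A := isNoetherian_of_linearEquiv (rightRegularEquiv A)
  obtain ⟨n, hn⟩ := monotone_stabilizes_iff_noetherian.2 this
    ⟨fun n => Submodule.span Aᵐᵒᵖ (f '' Set.Iio n), fun m n h =>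
      Submodule.span_mono (Set.image_mono (Set.Iio_subset_Iio h))⟩
  refine ⟨n, ?_⟩
  have : Submodule.span Aᵐᵒᵖ (f '' Set.Iio n) = Submodule.span Aᵐᵒᵖ (f '' Set.Iio (n + 1)) :=
    hn (n + 1) (Nat.le_succ n)
  rw [this]
  exact Submodule.subset_span ⟨n, by simp, rfl⟩

end RightNoetherian

end CrossedProduct

namespace CrossedProduct

/-! ### Right ideals generated by the elements `yⁱ r`. -/

section Cyclic

variable {A B : Type*} [Ring A] [Ring B]

/-- The right ideal generated by `r, y r, …, y ^ (n - 1) r`. -/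
def powerIdeal (y r : B) (n : ℕ) : Submodule Bᵐᵒᵖ B :=
  Submodule.span Bᵐᵒᵖ ((fun i => y ^ i * r) '' Set.Iio n)

theorem mul_mem_right {W : Submodule Bᵐᵒᵖ B} {x : B} (hx : x ∈ W) (z : B) : x * z ∈ W :=
  W.smul_mem (MulOpposite.op z) hx

theorem pow_mul_mem_powerIdeal (y r : B) {i n : ℕ} (h : i < n) : y ^ i * r ∈ powerIdeal y r n :=
  Submodule.subset_span ⟨i, h, rfl⟩

theorem powerIdeal_mono (y r : B) {m n : ℕ} (h : m ≤ n) : powerIdeal y r m ≤ powerIdeal y r n :=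
  Submodule.span_mono (Set.image_mono (Set.Iio_subset_Iio h))

theorem mul_mem_powerIdeal_succ {y r x : B} {n : ℕ} (hx : x ∈ powerIdeal y r n) :
    y * x ∈ powerIdeal y r (n + 1) := by
  induction hx using Submodule.span_induction with
  | mem x hx =>
    obtain ⟨i, hi, rfl⟩ := hx
    have := pow_mul_mem_powerIdeal y r (Nat.succ_lt_succ hi)
    rwa [pow_succ', mul_assoc] at this
  | zero => rw [mul_zero]; exact zero_mem _
  | add x z _ _ hx hz => rw [mul_add]; exact add_mem hx hz
  | smul c x _ hx =>
    have := mul_mem_right hx c.unop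
    rwa [mul_assoc] at this

theorem exists_eq_of_mem_powerIdeal_succ {y r x : B} {n : ℕ} (hx : x ∈ powerIdeal y r (n + 1)) :
    ∃ h : B, ∃ w ∈ powerIdeal y r n, x = r * h + y * w := by
  induction hx using Submodule.span_induction with
  | mem x hx =>
    obtain ⟨i, hi, rfl⟩ := hx
    rcases i with _ | i
    · exact ⟨1, 0, zero_mem _, by simp⟩
    · refine ⟨0, y ^ i * r, pow_mul_mem_powerIdeal y r (Nat.lt_of_succ_lt_succ hi), ?_⟩
      simp [pow_succ', mul_assoc]
  | zero => exact ⟨0, 0, zero_mem _, by simp⟩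
  | add x z _ _ hx hz =>
    obtain ⟨h, w, hw, rfl⟩ := hx
    obtain ⟨h', w', hw', rfl⟩ := hz
    exact ⟨h + h', w + w', add_mem hw hw', by noncomm_ring⟩
  | smul c x _ hx =>
    obtain ⟨h, w, hw, rfl⟩ := hx
    refine ⟨h * c.unop, w * c.unop, mul_mem_right hw _, ?_⟩
    change (r * h + y * w) * c.unop = _
    noncomm_ring

/-- If the set of all `z` with `y z ∈ r B` is contained in `r B`, and some power `y ^ n r` is a
right combination of the lower ones, then `y r ∈ r B`. -/
theorem exists_mul_eq_mul_of_mem_powerIdeal {y r : B}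
    (hyr : ∀ z x : B, y * z = r * x → ∃ u, z = r * u)
    {n : ℕ} (hn : y ^ (n + 1) * r ∈ powerIdeal y r (n + 1)) : ∃ u, y * r = r * u := by
  induction n with
  | zero =>
    obtain ⟨h, w, hw, hx⟩ := exists_eq_of_mem_powerIdeal_succ hn
    have hw0 : w = 0 := by simpa [powerIdeal] using hw
    exact ⟨h, by simpa [hw0] using hx⟩
  | succ n ih =>
    apply ih
    obtain ⟨h, w, hw, hx⟩ := exists_eq_of_mem_powerIdeal_succ hn
    -- Cancelling one `y` from `y(yⁿ⁺¹r - w) = rh` lowers the exponent by one.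
    obtain ⟨u, hu⟩ := hyr (y ^ (n + 1) * r - w) h (by
      rw [mul_sub, ← mul_assoc, ← pow_succ', hx, add_sub_cancel_right])
    rw [sub_eq_iff_eq_add] at hu
    rw [hu]
    refine add_mem (mul_mem_right ?_ u) hw
    simpa using pow_mul_mem_powerIdeal y r (Nat.succ_pos n)

variable {incl : A →+* B} {y : B} {d : A → A}

/-- With `rₙ = dⁿ(r)`, one has `yⁿ⁺¹r - rₙ₊₁ = y(yⁿr - rₙ) + rₙy`, and `rₙ` itself lies in the ideal
of level `n + 1`. -/
theorem pow_mul_sub_mem_powerIdeal (hd : ∀ a, y * incl a = incl a * y + incl (d a)) (r : A)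
    (n : ℕ) : y ^ n * incl r - incl (d^[n] r) ∈ powerIdeal y (incl r) n := by
  induction n with
  | zero => simp
  | succ n ih =>
    have h1 := mul_mem_powerIdeal_succ ih
    have h2 : incl (d^[n] r) * y ∈ powerIdeal y (incl r) (n + 1) := by
      have := sub_mem (pow_mul_mem_powerIdeal y (incl r) (Nat.lt_succ_self n))
        (powerIdeal_mono y _ (Nat.le_succ n) ih)
      rw [sub_sub_cancel] at this
      exact mul_mem_right this y
    have := add_mem h1 h2
    rw [Function.iterate_succ_apply']
    have h3 := hd (d^[n] r)
    convert this using 1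
    rw [mul_sub, h3, pow_succ', mul_assoc]
    abel

/-- A right dependence among the iterates `dⁱ(r)` in `A` transfers to the `yⁱr`, which agree with
them modulo lower terms. -/
theorem exists_pow_mul_mem_powerIdeal [IsNoetherianRing Aᵐᵒᵖ]
    (hd : ∀ a, y * incl a = incl a * y + incl (d a)) (r : A) :
    ∃ n, y ^ n * incl r ∈ powerIdeal y (incl r) n := by
  obtain ⟨n, hn⟩ := exists_mem_span_lt fun i => d^[i] r
  refine ⟨n, ?_⟩
  have key : ∀ x ∈ Submodule.span Aᵐᵒᵖ ((fun i => d^[i] r) '' Set.Iio n),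
      incl x ∈ powerIdeal y (incl r) n := by
    intro x hx
    induction hx using Submodule.span_induction with
    | mem x hx =>
      obtain ⟨i, hi, rfl⟩ := hx
      have := sub_mem (pow_mul_mem_powerIdeal y (incl r) hi)
        (powerIdeal_mono y _ (le_of_lt hi) (pow_mul_sub_mem_powerIdeal hd r i))
      rwa [sub_sub_cancel] at this
    | zero => rw [map_zero]; exact zero_mem _
    | add x z _ _ hx hz => rw [map_add]; exact add_mem hx hz
    | smul c x _ hx =>
      have := mul_mem_right hx (incl c.unop)
      rwa [← map_mul] at this
  have := add_mem (pow_mul_sub_mem_powerIdeal hd r n) (key _ hn)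
  rwa [sub_add_cancel] at this

end Cyclic

/-! ### Coefficient comparison in `A[g, δ]` and non-principality of the intersection. -/

section Main

variable {k : Type*} [Field k] {A : Type*} [Ring A] [Algebra k A]
  {G : Type*} [LieRing G] [LieAlgebra k G] {B : Type*} [Ring B] [Algebra k B]
  {ι : Type*} [LinearOrder ι] {b : Module.Basis ι k G}
  {incl : A →ₐ[k] B} {bar : G →ₗ[k] B}

/-- The inner perturbation `a ↦ δ_g a + (q a - a q)` of `δ_g`, the commutator with `ḡ + q`. -/
noncomputable def IsCrossedProduct.deltaAdd (hB : IsCrossedProduct b incl bar) (g : G) (q : A) :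
    A →+ A where
  toFun a := hB.delta g a + (q * a - a * q)
  map_zero' := by
    have := hB.delta_smul g 0 0
    simp only [zero_smul] at this
    simp [this]
  map_add' a c := by
    rw [hB.delta_add]
    noncomm_ring

theorem IsCrossedProduct.bar_add_mul_incl (hB : IsCrossedProduct b incl bar) (g : G) (q a : A) :
    (bar g + incl q) * incl a = incl a * (bar g + incl q) + incl (hB.deltaAdd g q a) := by
  simp only [IsCrossedProduct.deltaAdd, AddMonoidHom.coe_mk, ZeroHom.coe_mk, map_add, map_sub,
    map_mul, hB.incl_delta]
  noncomm_ring

/-- The element `∑ aₙ yⁿ`. -/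
noncomputable def polySum (incl : A →ₐ[k] B) (y : B) : (ℕ →₀ A) →+ B :=
  Finsupp.liftAddHom fun n =>
    (AddMonoidHom.mulRight (y ^ n)).comp (incl : A →+* B).toAddMonoidHom

theorem polySum_apply (incl : A →ₐ[k] B) (y : B) (f : ℕ →₀ A) :
    polySum incl y f = f.sum fun n a => incl a * y ^ n := rfl

theorem polySum_single (incl : A →ₐ[k] B) (y : B) (n : ℕ) (a : A) :
    polySum incl y (Finsupp.single n a) = incl a * y ^ n := by
  rw [polySum_apply, Finsupp.sum_single_index (by simp)]

theorem incl_mul_polySum (incl : A →ₐ[k] B) (y : B) (a : A) (f : ℕ →₀ A) :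
    incl a * polySum incl y f = polySum incl y (f.mapRange (a * ·) (mul_zero a)) := by
  induction f using Finsupp.induction_linear with
  | zero => simp
  | add f g hf hg =>
    rw [map_add, mul_add, hf, hg, Finsupp.mapRange_add (fun x z => mul_add a x z), map_add]
  | single n c => rw [Finsupp.mapRange_single, polySum_single, polySum_single, map_mul, mul_assoc]

theorem mul_polySum {y : B} {d : A →+ A} (hd : ∀ a, y * incl a = incl a * y + incl (d a))
    (f : ℕ →₀ A) :
    y * polySum incl y f =
      polySum incl y (f.mapDomain (· + 1) + f.mapRange d (map_zero d)) := by
  induction f using Finsupp.induction_linear with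
  | zero => simp
  | add f g hf hg =>
    rw [map_add, mul_add, hf, hg, Finsupp.mapRange_add (map_add d), Finsupp.mapDomain_add,
      ← map_add]
    congr 1
    abel
  | single n c =>
    rw [Finsupp.mapRange_single, Finsupp.mapDomain_single, map_add, polySum_single, polySum_single,
      polySum_single, ← mul_assoc, hd, pow_succ', add_mul, mul_assoc]

theorem IsCrossedProduct.exists_eq_polySum (hB : IsCrossedProduct b incl bar) (g : G) (q : A)
    {x : B} (hx : x ∈ oreSubalgebra incl bar g) :
    ∃ f : ℕ →₀ A, x = polySum incl (bar g + incl q) f := by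
  set y := bar g + incl q with hy
  -- Stability of the set of polynomials in `y` under left multiplication by `x` passes to products;
  -- applying it to `1` recovers `x`.
  suffices H : ∀ f : ℕ →₀ A, ∃ f' : ℕ →₀ A, x * polySum incl y f = polySum incl y f' by
    simpa [polySum_single] using H (Finsupp.single 0 1)
  induction hx using Algebra.adjoin_induction with
  | mem x hx =>
    rcases hx with ⟨a, rfl⟩ | hx
    · exact fun f => ⟨_, incl_mul_polySum incl y a f⟩
    · intro f
      rw [Set.mem_singleton_iff.1 hx, eq_sub_of_add_eq hy.symm, sub_mul,
        mul_polySum (hB.bar_add_mul_incl g q), incl_mul_polySum, ← map_sub]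
      exact ⟨_, rfl⟩
  | algebraMap c =>
    intro f
    rw [← incl.commutes]
    exact ⟨_, incl_mul_polySum incl y _ f⟩
  | add x z _ _ hx hz =>
    intro f
    obtain ⟨f₁, h₁⟩ := hx f
    obtain ⟨f₂, h₂⟩ := hz f
    exact ⟨f₁ + f₂, by rw [add_mul, h₁, h₂, map_add]⟩
  | mul x z _ _ hx hz =>
    intro f
    obtain ⟨f₁, h₁⟩ := hz f
    obtain ⟨f₂, h₂⟩ := hx f₁
    exact ⟨f₂, by rw [mul_assoc, h₁, h₂]⟩

variable (hB : IsCrossedProduct b incl bar) [IsDomain A]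
include hB

theorem IsCrossedProduct.polySum_injective {g : G} (hg : g ≠ 0) (q : A) :
    Function.Injective (polySum incl (bar g + incl q)) :=
  (injective_iff_map_eq_zero _).2 fun _ h => hB.eq_zero_of_sum_mul_pow hg h

theorem IsCrossedProduct.exists_eq_mul_of_incl_mul_eq_incl {r a : A} {x : B}
    (h : incl r * x = incl a) : ∃ c, a = r * c := by
  by_cases ha : a = 0
  · exact ⟨0, by simp [ha]⟩
  obtain ⟨_, c, rfl⟩ := hB.factors_of_mul_eq_incl ha h
  exact ⟨c, hB.incl_injective (by rw [← h, map_mul])⟩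

/-- If `r A` is stable under commutation with `ḡ + q` and the row `(r, ḡ + q)` is unimodular over
`A[g, δ]`, then `r` has a right inverse. -/
theorem IsCrossedProduct.exists_mul_eq_one {g : G} (hg : g ≠ 0) {r q : A} {s t : B}
    (hs : s ∈ oreSubalgebra incl bar g) (ht : t ∈ oreSubalgebra incl bar g)
    (hst : incl r * s + (bar g + incl q) * t = 1)
    (hd : ∀ a, ∃ c, hB.deltaAdd g q (r * a) = r * c) : ∃ c, r * c = 1 := by
  obtain ⟨s, rfl⟩ := hB.exists_eq_polySum g q hs
  obtain ⟨t, rfl⟩ := hB.exists_eq_polySum g q ht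
  have hone : (1 : B) = polySum incl (bar g + incl q) (Finsupp.single 0 1) := by
    simp [polySum_single]
  rw [incl_mul_polySum, mul_polySum (hB.bar_add_mul_incl g q), ← map_add, hone] at hst
  have hcoef := DFunLike.congr_fun (hB.polySum_injective hg q hst)
  have hzero : r * s 0 + hB.deltaAdd g q (t 0) = 1 := by
    have := hcoef 0
    have h0 : (t.mapDomain (· + 1)) 0 = 0 := Finsupp.mapDomain_of_notMem_range _ _ (by simp)
    simpa [h0] using this
  have hsucc : ∀ n, r * s (n + 1) + (t n + hB.deltaAdd g q (t (n + 1))) = 0 := by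
    intro n
    have := hcoef (n + 1)
    have h0 : (t.mapDomain (· + 1)) (n + 1) = t n :=
      Finsupp.mapDomain_apply (f := fun m : ℕ => m + 1) (add_left_injective 1) t n
    simpa [h0] using this
  -- Descending induction on `n`, run through `m`: coefficients beyond the support vanish, and `tₙ ≡
  -- -d(tₙ₊₁)` modulo `rA`.
  have hmem : ∀ m n, t.support.sup id < n + m → ∃ c, t n = r * c := by
    intro m
    induction m with
    | zero =>
      intro n hn
      refine ⟨0, ?_⟩
      rw [mul_zero]
      by_contra h
      exact absurd (Finset.le_sup (f := id) (Finsupp.mem_support_iff.2 h)) (not_le.2 hn)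
    | succ m ih =>
      intro n hn
      obtain ⟨c, hc⟩ := ih (n + 1) (by omega)
      obtain ⟨c', hc'⟩ := hd c
      have h := hsucc n
      rw [hc, hc'] at h
      refine ⟨-(s (n + 1) + c'), ?_⟩
      rw [mul_neg, mul_add, eq_neg_iff_add_eq_zero, ← h]
      abel
  obtain ⟨c, hc⟩ := hmem (t.support.sup id + 1) 0 (by omega)
  obtain ⟨c', hc'⟩ := hd c
  rw [hc, hc', ← mul_add] at hzero
  exact ⟨_, hzero⟩

theorem IsCrossedProduct.bar_add_incl_ne_incl {g : G} (hg : g ≠ 0) (q a : A) :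
    bar g + incl q ≠ incl a := by
  intro h
  have := hB.symbol_one_bar_ne_zero hg
  rw [← hB.symbol_one_bar_add_incl g q, h, hB.symbol_eq_zero (incl_mem_degreeLT a)] at this
  exact this rfl

theorem IsCrossedProduct.inf_not_principal [IsNoetherianRing Aᵐᵒᵖ] {g : G} (hg : g ≠ 0)
    {r q : A} (hr : ¬ IsUnit r) (hr0 : r ≠ 0) {s t : B}
    (hs : s ∈ oreSubalgebra incl bar g) (ht : t ∈ oreSubalgebra incl bar g)
    (hst : incl r * s + (bar g + incl q) * t = 1) (c : B) :
    principalRightIdeal (incl r) ⊓ principalRightIdeal (bar g + incl q) ≠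
      principalRightIdeal c := by
  intro hc
  have := hB.noZeroDivisors
  have hcomm := hB.bar_add_mul_incl g q
  have hy0 : bar g + incl q ≠ 0 := by
    simpa using hB.bar_add_incl_ne_incl hg q 0
  set y := bar g + incl q with hy
  set d := hB.deltaAdd g q
  have hmem : ∀ z, z ∈ principalRightIdeal c ↔
      (∃ x, z = incl r * x) ∧ ∃ x, z = y * x := fun z => by
    rw [← hc, Submodule.mem_inf, mem_principalRightIdeal, mem_principalRightIdeal]
  obtain ⟨⟨x₀, hx₀⟩, e, he⟩ := (hmem c).1 ((mem_principalRightIdeal c c).2 ⟨1, (mul_one c).symm⟩)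
  -- If `yz ∈ rB`, then `yz` lies in `cB = yeB`, and `y` cancels.
  have hye : ∀ z x, y * z = incl r * x → ∃ u, z = e * u := by
    intro z x hzx
    obtain ⟨u, hu⟩ := (mem_principalRightIdeal c _).1 ((hmem (y * z)).2 ⟨⟨x, hzx⟩, z, rfl⟩)
    refine ⟨u, mul_left_cancel₀ hy0 ?_⟩
    rw [hu, he, mul_assoc]
  -- With `d(r)z = rw`, one gets `y(rz) = r(yz + w)`, so the nonzero element `rz` of `A` lies in
  -- `eB` and its factor `e` lies in `A`.
  obtain ⟨z, w, hz, hzw⟩ := exists_mul_eq_mul hr0 (d r)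
  obtain ⟨u, hu⟩ := hye (incl (r * z)) (y * incl z + incl w) (by
    rw [map_mul, ← mul_assoc, hcomm, add_mul, mul_assoc, ← map_mul incl (d r), hzw, map_mul,
      ← mul_add])
  obtain ⟨⟨a, rfl⟩, -⟩ := hB.factors_of_mul_eq_incl (mul_ne_zero hr0 hz) hu.symm
  -- Now `e = a` and `c = ya = ay + d(a)` lies in `rB`, which forces `a ∈ rA`.
  obtain ⟨a', rfl⟩ := hB.exists_eq_mul_of_mul_bar hg (a' := d a) (q := q) hr0
    (by rw [← hx₀, he, hcomm])
  have hyr : ∀ z x : B, y * z = incl r * x → ∃ u, z = incl r * u := by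
    intro z x hzx
    obtain ⟨u, rfl⟩ := hye z x hzx
    exact ⟨incl a' * u, by rw [map_mul, mul_assoc]⟩
  obtain ⟨n, hn⟩ := exists_pow_mul_mem_powerIdeal (incl := (incl : A →+* B)) (d := d) hcomm r
  have hn0 : n ≠ 0 := by
    rintro rfl
    have : incl r = 0 := by simpa [powerIdeal] using hn
    exact hr0 (hB.incl_injective (by rw [this, map_zero]))
  obtain ⟨m, rfl⟩ := Nat.exists_eq_succ_of_ne_zero hn0
  obtain ⟨u, hu⟩ := exists_mul_eq_mul_of_mem_powerIdeal hyr hn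
  have hstable : ∀ a, ∃ c, d (r * a) = r * c := by
    intro a
    -- From `yr = ru` follows `d(ra) = y(ra) - (ra)y = r(ua - ay)`.
    refine hB.exists_eq_mul_of_incl_mul_eq_incl (x := u * incl a - incl a * y) ?_
    have h1 := hcomm (r * a)
    rw [← sub_eq_iff_eq_add'] at h1
    rw [← h1, map_mul, mul_sub, ← mul_assoc, ← hu]
    noncomm_ring
  obtain ⟨r', hr'⟩ := hB.exists_mul_eq_one hg hs ht hst hstable
  exact hr (IsUnit.of_mul_eq_one r' hr')

end Main

end CrossedProduct

theorem mainTheorem4 {k : Type*} [Field k] {A : Type*} [Ring A] [Algebra k A] [IsDomain A]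
    [IsNoetherianRing A] [IsNoetherianRing Aᵐᵒᵖ]
    {G : Type*} [LieRing G] [LieAlgebra k G] {ι : Type*} [LinearOrder ι]
    (b : Module.Basis ι k G)
    {B : Type*} [Ring B] [Algebra k B] [InvariantBasisNumber Bᵐᵒᵖ]
    (incl : A →ₐ[k] B) (bar : G →ₗ[k] B)
    (hB : CrossedProduct.IsCrossedProduct b incl bar)
    (g : G) (hg : g ≠ 0) (r q : A) (hr : ¬ IsUnit r)
    (huni : CrossedProduct.IsUnimodularRow
      ![CrossedProduct.oreCoeff incl bar g r,
        CrossedProduct.oreGen incl bar g + CrossedProduct.oreCoeff incl bar g q]) :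
    CrossedProduct.IsNontrivialStablyFree Bᵐᵒᵖ
      (CrossedProduct.principalRightIdeal (incl r) ⊓
        CrossedProduct.principalRightIdeal (bar g + incl q) : Submodule Bᵐᵒᵖ B) := by
  have := hB.noZeroDivisors
  obtain ⟨f, hf⟩ := huni
  have hst : incl r * (f 0 : B) + (bar g + incl q) * (f 1 : B) = 1 := by
    simpa [Fin.sum_univ_two, CrossedProduct.oreCoeff, CrossedProduct.oreGen] using
      congrArg Subtype.val hf
  have hy0 : bar g + incl q ≠ 0 := by
    simpa using hB.bar_add_incl_ne_incl hg q 0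
  -- If `r = 0`, then `y` divides `1` and so lies in `A`, although it has degree one.
  have hr0 : r ≠ 0 := by
    rintro rfl
    rw [map_zero, zero_mul, zero_add, ← map_one incl] at hst
    obtain ⟨⟨a, ha⟩, -⟩ := hB.factors_of_mul_eq_incl one_ne_zero hst
    exact hB.bar_add_incl_ne_incl hg q a ha
  have hr0' : incl r ≠ 0 := (map_ne_zero_iff incl hB.incl_injective).2 hr0
  obtain ⟨e⟩ := CrossedProduct.nonempty_inf_prod_equiv_of_unimodular
    (fun x hx => (mul_eq_zero.1 hx).resolve_left hr0')
    (fun x hx => (mul_eq_zero.1 hx).resolve_left hy0) hst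
  obtain ⟨hfin, hsf⟩ := CrossedProduct.finite_and_isStablyFree_of_prod_equiv e
  refine ⟨hfin, hsf, fun hfree => ?_⟩
  obtain ⟨c, hc⟩ := CrossedProduct.exists_span_singleton_eq_top e
  refine hB.inf_not_principal hg hr hr0 (f 0).2 (f 1).2 hst (c : B) ?_
  have := congrArg (Submodule.map (Submodule.subtype _)) hc
  rw [Submodule.map_span, Set.image_singleton, Submodule.map_subtype_top] at this
  exact this.symm
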